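/- For a cardinal $\chi$ put $\beth_0(\chi)=\chi$ and $\beth_{k+1}(\chi)=2^{\beth_k(\chi)}$. For a cardinal $\lambda$ (identified with its initial ordinal) and $n<\omega$, let ${}^{n\ge}\lambda$ be the set of all sequences of elements of $\lambda$ of length at most $n$, and let ${}^{n>}\lambda$ be the set of those of length less than $n$. View ${}^{n\ge}\lambda$ as a structure in the language $L_s=\{\trianglelefteq,\wedge,<_{\mathrm{lex}},(P_d)_{d<\omega}\}$, where $\eta\trianglelefteq\nu$ means that $\eta$ is an initial segment of $\nu$; $\eta\wedge\nu$ is the longest common initial segment of $\eta$ and $\nu$; $\eta<_{\mathrm{lex}}\nu$ means that either $\eta$ is a proper initial segment of $\nu$, or $\eta,\nu$ are $\trianglelefteq$-incomparable and $\eta(i)<\nu(i)$ for the least $i$ with $\eta(i)\ne\nu(i)$; and $P_d(\eta)$ means that $\eta$ has length $d$. For $m$-tuples $\bar\eta,\bar\nu$ from ${}^{n\ge}\lambda$ write $\bar\eta\sim_s\bar\nu$ if $\bar\eta$ and $\bar\nu$ satisfy the same quantifier-free $L_s$-formulas (with equality) in ${}^{n\ge}\lambda$. Theorem. For all $n,m<\omega$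 there is $k=k(n,m)<\omega$ such that for every infinite cardinal $\chi$ the following holds for $\lambda:=\beth_k(\chi)^+$. For every function $f:({}^{n\ge}\lambda)^m\to\chi$ there is an $L_s$-substructure $\mathcal I\subseteq{}^{n\ge}\lambda$ such that (i) $\langle\,\rangle\in\mathcal I$, and for each $\eta\in\mathcal I\cap{}^{n>}\lambda$ we have $\|\{\alpha<\lambda:\eta^\frown\langle\alpha\rangle\in\mathcal I\}\|\ge\chi^+$; (ii) if $\bar\eta,\bar\nu$ are $m$-tuples from $\mathcal I$ with $\bar\eta\sim_s\bar\nu$, then $f(\bar\eta)=f(\bar\nu)$. -/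

import Mathlib

open Cardinal

universe u

/-- The iterated power `ℶ_k(χ)` over `χ`: `ℶ_0(χ) = χ` and `ℶ_{k+1}(χ) = 2 ^ ℶ_k(χ)`. -/
noncomputable def bethOver (χ : Cardinal.{u}) : ℕ → Cardinal.{u}
  | 0 => χ
  | k + 1 => 2 ^ bethOver χ k

/-- Function symbols of the Shelah language: the binary meet `∧`. -/
inductive ShelahFunc : ℕ → Type
  | meet : ShelahFunc 2

/-- Relation symbols of the Shelah language: the initial segment relation `⊴`, the lexicographic
order `<_lex`, and for each `d : ℕ` a unary predicate for level `d`. -/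
inductive ShelahRel : ℕ → Type
  | initSeg : ShelahRel 2
  | lex : ShelahRel 2
  | level (d : ℕ) : ShelahRel 1

/-- The Shelah language `L_s = {⊴, ∧, <_lex, (P_d)_{d < ω}}`. -/
def shelahLang : FirstOrder.Language.{0, 0} := ⟨ShelahFunc, ShelahRel⟩

open Classical in
/-- The longest common initial segment of two finite sequences. -/
noncomputable def seqMeet {A : Type u} : List A → List A → List A
  | a :: s, b :: t => if a = b then a :: seqMeet s t else []
  | _, _ => []

theorem seqMeet_length_le {A : Type u} (s t : List A) : (seqMeet s t).length ≤ s.length := by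
  induction s generalizing t with
  | nil => simp [seqMeet]
  | cons a s ih =>
    cases t with
    | nil => simp [seqMeet]
    | cons b t =>
      by_cases h : a = b
      · simpa [seqMeet, h] using ih t
      · simp [seqMeet, h]

/-- The full tree of finite sequences of elements of the linear order `A`, as an `L_s`-structure.
Sequences are lists, `List.Lex (· < ·)` puts a proper initial segment before its extensions and
otherwise compares at the first place of difference. -/
noncomputable instance seqTreeStructure (A : Type u) [LinearOrder A] :
    shelahLang.Structure (List A) where
  funMap {_} g := match g with
    | ShelahFunc.meet => fun x => seqMeet (x 0) (x 1)
  RelMap {_} r := match r with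
    | ShelahRel.initSeg => fun x => x 0 <+: x 1
    | ShelahRel.lex => fun x => List.Lex (· < ·) (x 0) (x 1)
    | ShelahRel.level d => fun x => (x 0).length = d

/-- The sequences of length at most `n`, as an `L_s`-substructure of the full tree. -/
noncomputable def boundedTree (A : Type u) [LinearOrder A] (n : ℕ) :
    shelahLang.Substructure (List A) where
  carrier := {s | s.length ≤ n}
  fun_mem g := match g with
    | ShelahFunc.meet => fun x hx => (seqMeet_length_le (x 0) (x 1)).trans (hx 0)

/-- Two tuples of a structure have the same quantifier-free type. -/
def SameQFType (L : FirstOrder.Language) {M : Type*} [L.Structure M] {ι : Type*} (x y : ι → M) : Prop :=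
  ∀ φ : L.Formula ι, φ.IsQF → (φ.Realize x ↔ φ.Realize y)

/-- The `s`-similarity of tuples from the tree of sequences of length at most `n`. -/
def SSimilar {A : Type u} [LinearOrder A] {n : ℕ} {ι : Type*} (x y : ι → boundedTree A n) : Prop :=
  SameQFType shelahLang x y

/-- The substructure `I` of the tree of sequences of length at most `n` contains the empty sequence,
and every `η ∈ I` of length less than `n` has at least `μ` one-point extensions in `I`. -/
def IsFullyBranching {A : Type u} [LinearOrder A] {n : ℕ}
    (I : shelahLang.Substructure (boundedTree A n)) (μ : Cardinal.{u}) : Prop :=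
  (⟨[], Nat.zero_le n⟩ : boundedTree A n) ∈ I ∧
    ∀ η ∈ I, (η : List A).length < n →
      μ ≤ #{a : A | ∃ ν ∈ I, (ν : List A) = (η : List A) ++ [a]}

/-! Put λ = `l` and B = χ⁺. Label every list over B of length at most n by an element of λ, strictly
increasingly for the lexicographic order, and send a list to the sequence of labels of its nonempty
initial segments (`pathImage`). This copies the tree over B into the tree over λ, keeping lengths,
meets and lexicographic order.

The order between two labels is the lexicographic order between initial segments, which depends only
on the lengths, the meets and the order of the lists (`take_lt_take_iff`). Hence similar tuples in
the copy have label sets of one size, at most m * n, inside which their entries occupy the same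
ranks (`pathLabels_lt_iff`, `pathCode_eq`).

A tuple is recovered from its label set and these ranks. So colour each finite set of labels by the
function taking a rank pattern to the value of f: there are at most 2^χ colours. Erdős–Rado
(`erdos_rado`) gives a homogeneous set H with more than 2^χ elements, and the labels can be chosen
in H (`exists_strictMonoOn_list`). On such a copy f depends on the rank pattern and the size of the
label set only. -/

/-! ### The Erdős–Rado theorem, by end-homogeneous sets. -/

section ErdosRado

variable {A C : Type u} [LinearOrder A] [WellFoundedLT A]

/-- The predecessors of `y` in the Erdős–Rado tree of the colouring `f` on `S`: those `x < y` in `S`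
which look like `y` over the predecessors of `y` below `x`. -/
noncomputable def IsEndPred (S : Set A) (f : Finset A → C) (y : A) : A → Prop :=
  (wellFounded_lt (α := A)).fix fun x ih =>
    x ∈ S ∧ x < y ∧ ∀ s : Finset A, (∀ w ∈ s, ∃ h : w < x, ih w h) → f (insert x s) = f (insert y s)

theorem isEndPred_iff {S : Set A} {f : Finset A → C} {x y : A} :
    IsEndPred S f y x ↔ x ∈ S ∧ x < y ∧
      ∀ s : Finset A, (∀ w ∈ s, w < x ∧ IsEndPred S f y w) → f (insert x s) = f (insert y s) := by
  rw [IsEndPred, WellFounded.fix_eq]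
  simp only [exists_prop]

/-- An order isomorphism between the predecessors of `y` and `z` which respects the colouring. -/
def IsEndIso (S : Set A) (f : Finset A → C) (y z : A)
    (φ : {x // IsEndPred S f y x} ≃o {x // IsEndPred S f z x}) : Prop :=
  ∀ s : Finset {x // IsEndPred S f y x},
    f (insert y (s.map (Function.Embedding.subtype _))) =
      f (insert z ((s.map φ.toEquiv.toEmbedding).map (Function.Embedding.subtype _)))

variable {S : Set A} {f : Finset A → C} {y z : A}
  {φ : {x // IsEndPred S f y x} ≃o {x // IsEndPred S f z x}}

theorem IsEndIso.symm (h : IsEndIso S f y z φ) : IsEndIso S f z y φ.symm := by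
  intro s
  rw [h]
  congr 3
  ext a
  simp

theorem IsEndIso.insert_eq (h : IsEndIso S f y z φ) (s : Finset A)
    (hs : ∀ w ∈ s, ∃ hw : IsEndPred S f y w, (φ ⟨w, hw⟩ : A) = w) :
    f (insert y s) = f (insert z s) := by
  classical
  have h1 := h (s.subtype _)
  have h2 : (s.subtype (IsEndPred S f y)).map (Function.Embedding.subtype _) = s := by
    rw [Finset.subtype_map, Finset.filter_true_of_mem]
    exact fun w hw => (hs w hw).1
  have h3 : ((s.subtype (IsEndPred S f y)).map φ.toEquiv.toEmbedding).map
      (Function.Embedding.subtype _) = s := by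
    ext a
    constructor
    · intro ha
      simp only [Finset.mem_map] at ha
      obtain ⟨b, ⟨c, hc, rfl⟩, rfl⟩ := ha
      rw [Finset.mem_subtype] at hc
      obtain ⟨h4, h5⟩ := hs _ hc
      change (φ c : A) ∈ s
      have : (φ c : A) = c := h5
      rwa [this]
    · intro ha
      obtain ⟨h4, h5⟩ := hs _ ha
      simp only [Finset.mem_map]
      exact ⟨_, ⟨⟨a, h4⟩, by simpa using ha, rfl⟩, h5⟩
  rwa [h2, h3] at h1

/-- If x were moved up, it would itself be a predecessor of z; its preimage would lie below x, hence
be fixed, hence equal x. -/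
theorem IsEndIso.not_lt_apply (h : IsEndIso S f y z φ) {x : A} (hx : IsEndPred S f y x)
    (ih : ∀ w (hw : IsEndPred S f y w), w < x → (φ ⟨w, hw⟩ : A) = w) :
    ¬ x < φ ⟨x, hx⟩ := by
  intro hlt
  obtain ⟨hxS, hxy, hxs⟩ := isEndPred_iff.1 hx
  have hφ := isEndPred_iff.1 (φ ⟨x, hx⟩).2
  have key : ∀ w, w < x → IsEndPred S f z w → ∃ hw : IsEndPred S f y w, (φ ⟨w, hw⟩ : A) = w := by
    intro w hwx hw
    have h1 : φ.symm ⟨w, hw⟩ < ⟨x, hx⟩ := by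
      rw [OrderIso.symm_apply_lt]
      exact hwx.trans hlt
    have h2 := ih _ (φ.symm ⟨w, hw⟩).2 h1
    simp only [Subtype.coe_eta, OrderIso.apply_symm_apply] at h2
    have h3 : IsEndPred S f y w := by rw [h2]; exact (φ.symm ⟨w, hw⟩).2
    exact ⟨h3, ih _ h3 hwx⟩
  have hz : IsEndPred S f z x := by
    rw [isEndPred_iff]
    refine ⟨hxS, hlt.trans hφ.2.1, fun s hs => ?_⟩
    rw [hxs s fun w hw => ⟨(hs w hw).1, (key w (hs w hw).1 (hs w hw).2).1⟩]
    exact h.insert_eq s fun w hw => key w (hs w hw).1 (hs w hw).2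
  have h1 : φ.symm ⟨x, hz⟩ < ⟨x, hx⟩ := by
    rw [OrderIso.symm_apply_lt]
    exact hlt
  have h2 := ih _ (φ.symm ⟨x, hz⟩).2 h1
  simp only [Subtype.coe_eta, OrderIso.apply_symm_apply] at h2
  have h3 : ((φ.symm ⟨x, hz⟩ : {x // IsEndPred S f y x}) : A) < x := h1
  exact h3.ne h2.symm

theorem IsEndIso.apply_eq (h : IsEndIso S f y z φ) (x : A) (hx : IsEndPred S f y x) :
    (φ ⟨x, hx⟩ : A) = x := by
  induction x using WellFoundedLT.induction with
  | ind x ih =>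
    refine le_antisymm (not_lt.1 (h.not_lt_apply hx fun w hw hwx => ih w hwx hw)) (not_lt.1 fun hlt => ?_)
    refine h.symm.not_lt_apply (φ ⟨x, hx⟩).2 (fun w hw hwx => ?_) (by simpa using hlt)
    have h1 : φ.symm ⟨w, hw⟩ < ⟨x, hx⟩ := by
      rw [OrderIso.symm_apply_lt]
      exact hwx
    have h2 := ih _ h1 (φ.symm ⟨w, hw⟩).2
    simp only [Subtype.coe_eta, OrderIso.apply_symm_apply] at h2
    exact h2.symm

/-- The isomorphism is the identity, so for y < z the point y would qualify as a predecessor of z,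
hence as one of itself. -/
theorem IsEndIso.not_lt_base (h : IsEndIso S f y z φ) (hy : y ∈ S) : ¬ y < z := by
  intro hlt
  have key : ∀ w, IsEndPred S f z w → IsEndPred S f y w := fun w hw => by
    have := h.symm.apply_eq w hw
    rw [← this]
    exact (φ.symm ⟨w, hw⟩).2
  have hz : IsEndPred S f z y := by
    rw [isEndPred_iff]
    refine ⟨hy, hlt, fun s hs => h.insert_eq s fun w hw => ?_⟩
    exact ⟨key w (hs w hw).2, h.apply_eq _ _⟩
  exact lt_irrefl _ (isEndPred_iff.1 (key y hz)).2.1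

theorem IsEndIso.base_eq (h : IsEndIso S f y z φ) (hy : y ∈ S) (hz : z ∈ S) : y = z :=
  le_antisymm (not_lt.1 (h.symm.not_lt_base hz)) (not_lt.1 (h.not_lt_base hy))

/-- The isomorphism type of the predecessors of `y`, coded by an embedding into `W`. -/
noncomputable def endCode {W : Type u} (S : Set A) (f : Finset A → C) (y : A)
    (e : {x // IsEndPred S f y x} ↪ W) : Set W × Set (W × W) × (Finset W → C) :=
  (Set.range e, {p | ∃ a b, a < b ∧ (e a, e b) = p}, fun t =>
    f (insert y ((t.preimage e e.injective.injOn).map (Function.Embedding.subtype _))))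

theorem eq_of_endCode_eq {W : Type u} (hy : y ∈ S) (hz : z ∈ S)
    (e : {x // IsEndPred S f y x} ↪ W) (e' : {x // IsEndPred S f z x} ↪ W)
    (h : endCode S f y e = endCode S f z e') : y = z := by
  simp only [endCode, Prod.mk.injEq] at h
  obtain ⟨h1, h2, h3⟩ := h
  let g : {x // IsEndPred S f y x} ≃ {x // IsEndPred S f z x} :=
    (Equiv.ofInjective e e.injective).trans
      ((Equiv.setCongr h1).trans (Equiv.ofInjective e' e'.injective).symm)
  have hg : ∀ a, e' (g a) = e a := fun a => by
    simp only [g, Equiv.trans_apply, Equiv.apply_ofInjective_symm]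
    rfl
  have lt_iff : ∀ a b, g a < g b ↔ a < b := fun a b => by
    have hab : (e a, e b) ∈ {p : W × W | ∃ a b, a < b ∧ (e a, e b) = p} ↔
        (e a, e b) ∈ {p : W × W | ∃ a b, a < b ∧ (e' a, e' b) = p} := by rw [h2]
    simp only [Set.mem_ofPred_eq, Prod.mk.injEq, e.injective.eq_iff] at hab
    rw [← hg a, ← hg b] at hab
    simp only [e'.injective.eq_iff] at hab
    constructor
    · intro hlt
      obtain ⟨a', b', h4, rfl, rfl⟩ := hab.2 ⟨_, _, hlt, rfl, rfl⟩
      exact h4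
    · intro hlt
      obtain ⟨a', b', h4, rfl, rfl⟩ := hab.1 ⟨_, _, hlt, rfl, rfl⟩
      exact h4
  have le_iff : ∀ a b, g a ≤ g b ↔ a ≤ b := fun a b => by
    rw [← not_lt, ← not_lt]
    exact not_congr (lt_iff b a)
  let φ : {x // IsEndPred S f y x} ≃o {x // IsEndPred S f z x} := ⟨g, le_iff _ _⟩
  refine IsEndIso.base_eq (φ := φ) (fun s => ?_) hy hz
  have h4 := congrFun h3 (s.map e)
  have h5 : (s.map e).preimage e e.injective.injOn = s := by
    ext a; simp
  have h6 : (s.map e).preimage e' e'.injective.injOn = s.map φ.toEquiv.toEmbedding := by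
    ext a
    obtain ⟨b, rfl⟩ := g.surjective a
    rw [Finset.mem_preimage, hg, Finset.mem_map', Finset.mem_map]
    constructor
    · exact fun hb => ⟨b, hb, rfl⟩
    · rintro ⟨c, hc, h7⟩
      have : c = b := g.injective h7
      rwa [← this]
  rwa [h5, h6] at h4

theorem mk_endCode_le {κ : Cardinal.{u}} {W : Type u} (hκ : ℵ₀ ≤ κ) (hW : #W = κ) (hC : #C ≤ κ) :
    #(Set W × Set (W × W) × (Finset W → C)) ≤ 2 ^ κ := by
  have : Infinite W := by rw [infinite_iff, hW]; exact hκ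
  have hpow : ℵ₀ ≤ 2 ^ κ := hκ.trans (cantor κ).le
  have h1 : #C ^ κ ≤ 2 ^ κ := (power_le_power_right hC).trans (power_self_eq hκ).le
  simp only [mk_prod, mk_set, mk_arrow, lift_id, mk_finset_of_infinite, hW, mul_eq_self hκ]
  calc _ ≤ (2 : Cardinal.{u}) ^ κ * (2 ^ κ * 2 ^ κ) := by gcongr
    _ = 2 ^ κ := by rw [mul_eq_self hpow, mul_eq_self hpow]

/-- A colouring of finite sets has large end-homogeneous sets. -/
theorem exists_endHomogeneous {κ : Cardinal.{u}} (hκ : ℵ₀ ≤ κ) (hC : #C ≤ κ) (S : Set A)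
    (hS : 2 ^ κ < #S) (f : Finset A → C) :
    ∃ H ⊆ S, κ < #H ∧ ∀ s : Finset A, ↑s ⊆ H → ∀ y ∈ H, ∀ z ∈ H,
      (∀ x ∈ s, x < y ∧ x < z) → f (insert y s) = f (insert z s) := by
  by_cases hbig : ∃ y ∈ S, κ < #{x // IsEndPred S f y x}
  · obtain ⟨t, -, ht⟩ := hbig
    refine ⟨{x | IsEndPred S f t x}, fun x hx => (isEndPred_iff.1 hx).1, ht,
      fun s hs y hy z hz hlt => ?_⟩
    -- Both colours equal the colour of `insert t s`.
    rw [(isEndPred_iff.1 hy).2.2 s fun w hw => ⟨(hlt w hw).1, hs hw⟩,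
      (isEndPred_iff.1 hz).2.2 s fun w hw => ⟨(hlt w hw).2, hs hw⟩]
  · exfalso
    push Not at hbig
    have hW : #κ.ord.ToType = κ := mk_ord_toType κ
    have hemb : ∀ y : S, Nonempty ({x // IsEndPred S f y x} ↪ κ.ord.ToType) := fun y => by
      have := hbig y y.2
      rwa [← hW] at this
    let e := fun y => (hemb y).some
    have hinj : Function.Injective fun y : S => endCode S f (y : A) (e y) := fun y z h =>
      Subtype.ext (eq_of_endCode_eq y.2 z.2 _ _ h)
    exact hS.not_ge ((mk_le_of_injective hinj).trans (mk_endCode_le hκ hW hC))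

theorem le_bethOver (κ : Cardinal.{u}) (M : ℕ) : κ ≤ bethOver κ M := by
  induction M with
  | zero => exact le_rfl
  | succ M ih => exact ih.trans (cantor _).le

theorem bethOver_two_power (κ : Cardinal.{u}) (M : ℕ) :
    bethOver (2 ^ κ) M = bethOver κ (M + 1) := by
  induction M with
  | zero => rfl
  | succ M ih => rw [bethOver, ih]; rfl

/-- The **Erdős–Rado theorem**. -/
theorem erdos_rado {κ : Cardinal.{u}} (hκ : ℵ₀ ≤ κ) (hC : #C ≤ κ) (M : ℕ) (S : Set A)
    (hS : bethOver κ M < #S) (f : Finset A → C) :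
    ∃ H ⊆ S, κ < #H ∧ ∀ s t : Finset A, ↑s ⊆ H → ↑t ⊆ H → s.card = t.card → s.card ≤ M →
      f s = f t := by
  induction M generalizing S f with
  | zero =>
    refine ⟨S, subset_rfl, hS, fun s t _ _ hst hs => ?_⟩
    rw [Nat.le_zero, Finset.card_eq_zero] at hs
    subst hs
    rw [Finset.card_empty, eq_comm, Finset.card_eq_zero] at hst
    rw [hst]
  | succ M ih =>
    obtain ⟨H, hHS, hH, hend⟩ := exists_endHomogeneous (hκ.trans (le_bethOver κ M))
      (hC.trans (le_bethOver κ M)) S hS f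
    classical
    -- By end-homogeneity the choice of the upper point is irrelevant. The `else` value is never met
    -- in `hmax`, where the removed maximum is such a point.
    let g : Finset A → C := fun s =>
      if h : ∃ y ∈ H, ∀ x ∈ s, x < y then f (insert h.choose s) else f s
    have hg : ∀ s : Finset A, ↑s ⊆ H → ∀ y ∈ H, (∀ x ∈ s, x < y) → f (insert y s) = g s := by
      intro s hs y hy hlt
      have h : ∃ y ∈ H, ∀ x ∈ s, x < y := ⟨y, hy, hlt⟩
      simp only [g, dif_pos h]
      exact hend s hs y hy _ h.choose_spec.1 fun x hx => ⟨hlt x hx, h.choose_spec.2 x hx⟩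
    obtain ⟨H', hH', hκH', hom⟩ := ih H hH g
    have hmax : ∀ (s : Finset A) (hs : s.Nonempty), ↑s ⊆ H' → f s = g (s.erase (s.max' hs)) := by
      intro s hs hsH
      rw [← hg _ (fun x hx => hH' (hsH (Finset.mem_of_mem_erase hx))) _
        (hH' (hsH (s.max'_mem hs))) fun x hx => ?_, Finset.insert_erase (s.max'_mem hs)]
      exact s.lt_max'_of_mem_erase_max' hs hx
    refine ⟨H', hH'.trans hHS, hκH', fun s t hs ht hst hsM => ?_⟩
    rcases s.eq_empty_or_nonempty with rfl | hne
    · rw [Finset.card_empty, eq_comm, Finset.card_eq_zero] at hst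
      rw [hst]
    · have hne' : t.Nonempty := by rwa [← Finset.card_pos, ← hst, Finset.card_pos]
      rw [hmax s hne hs, hmax t hne' ht]
      have h1 := Finset.card_erase_of_mem (s.max'_mem hne)
      have h2 := Finset.card_erase_of_mem (t.max'_mem hne')
      refine hom _ _ (fun x hx => hs (Finset.mem_of_mem_erase hx))
        (fun x hx => ht (Finset.mem_of_mem_erase hx)) ?_ ?_ <;> omega

end ErdosRado

/-! ### Copying a tree along a lexicographically increasing labelling. -/

section PathImage

variable {A B : Type u}

/-- The branch which passes through the labels of the nonempty initial segments of a list. -/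
def pathImage (h : List B → A) : List B → List B → List A
  | _, [] => []
  | pre, b :: l => h (pre ++ [b]) :: pathImage h (pre ++ [b]) l

theorem length_pathImage (h : List B → A) (pre p : List B) :
    (pathImage h pre p).length = p.length := by
  induction p generalizing pre with
  | nil => rfl
  | cons b p ih => simp [pathImage, ih]

theorem pathImage_append_singleton (h : List B → A) (pre p : List B) (b : B) :
    pathImage h pre (p ++ [b]) = pathImage h pre p ++ [h (pre ++ p ++ [b])] := by
  induction p generalizing pre with
  | nil => simp [pathImage]
  | cons c p ih => simp [pathImage, ih]

theorem pathImage_eq_map (h : List B → A) (pre p : List B) :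
    pathImage h pre p = (List.range p.length).map fun j => h (pre ++ p.take (j + 1)) := by
  induction p generalizing pre with
  | nil => rfl
  | cons b p ih =>
    simp [pathImage, ih, List.range_succ_eq_map, Function.comp_def]

variable [LinearOrder A] [LinearOrder B]

/-- Take the least first entry, then recurse on the tails. The length bound is essential: b, ab,
aab, … descends when a < b. -/
theorem exists_lex_min [WellFoundedLT B] (n : ℕ) (S : Set (List B)) (hS : S.Nonempty)
    (hn : ∀ l ∈ S, l.length ≤ n) : ∃ p ∈ S, ∀ q ∈ S, ¬ q < p := by
  induction n generalizing S with
  | zero =>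
    obtain ⟨p, hp⟩ := hS
    refine ⟨p, hp, fun q _ hq => ?_⟩
    have := List.length_eq_zero_iff.1 (Nat.le_zero.1 (hn p hp))
    subst this
    exact List.not_lt_nil _ hq
  | succ n ih =>
    by_cases h0 : [] ∈ S
    · exact ⟨[], h0, fun q _ hq => List.not_lt_nil _ hq⟩
    · have hne : {b : B | ∃ l, b :: l ∈ S}.Nonempty := by
        obtain ⟨p, hp⟩ := hS
        cases p with
        | nil => exact absurd hp h0
        | cons b l => exact ⟨b, l, hp⟩
      obtain ⟨b, ⟨l, hl⟩, hb⟩ := (wellFounded_lt (α := B)).has_min _ hne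
      obtain ⟨p, hp, hmin⟩ := ih {l | b :: l ∈ S} ⟨l, hl⟩
        fun l hl => by simpa using hn _ hl
      refine ⟨b :: p, hp, fun q hq hlt => ?_⟩
      cases q with
      | nil => exact h0 hq
      | cons c q =>
        rw [List.cons_lt_cons_iff] at hlt
        rcases hlt with h | ⟨rfl, h⟩
        · exact hb c ⟨q, hq⟩ h
        · exact hmin q hq h

theorem wellFoundedLT_boundedList [WellFoundedLT B] (n : ℕ) :
    WellFoundedLT {l : List B // l.length ≤ n} := by
  refine ⟨WellFounded.wellFounded_iff_has_min.2 fun S hS => ?_⟩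
  obtain ⟨p, ⟨q, hq, rfl⟩, hmin⟩ := exists_lex_min n (Subtype.val '' S) (hS.image _)
    (by rintro _ ⟨l, -, rfl⟩; exact l.2)
  exact ⟨q, hq, fun x hx hlt => hmin _ ⟨x, hx, rfl⟩ hlt⟩

/-- Bounded lists over a small well-order embed lexicographically into any larger set of a
well-order. -/
theorem exists_strictMonoOn_list [WellFoundedLT A] [WellFoundedLT B] [Infinite B] (n : ℕ)
    (H : Set A) (hH : #B < #H) :
    ∃ h : List B → A, (∀ l, l.length ≤ n → h l ∈ H) ∧
      StrictMonoOn h {l | l.length ≤ n} := by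
  have := wellFoundedLT_boundedList (B := B) n
  have hcard : #{l : List B // l.length ≤ n} < #H :=
    ((mk_subtype_le _).trans (mk_list_eq_mk B).le).trans_lt hH
  -- The lists may have a larger order type than `B`, but they have no larger cardinality; this is
  -- why `#B < #H` must be strict.
  have hle : Ordinal.type (α := {l : List B // l.length ≤ n}) (· < ·) ≤
      Ordinal.type (α := H) (· < ·) := by
    by_contra hlt
    have := Ordinal.card_le_card (not_le.1 hlt).le
    rw [Ordinal.card_type, Ordinal.card_type] at this
    exact this.not_gt hcard
  obtain ⟨e⟩ := Ordinal.type_le_iff'.1 hle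
  refine ⟨fun l => if hl : l.length ≤ n then e ⟨l, hl⟩ else e ⟨[], Nat.zero_le n⟩,
    fun l hl => ?_, fun p hp q hq hpq => ?_⟩
  · simp only [dif_pos hl]
    exact (e _).2
  · simp only [Set.mem_ofPred_eq] at hp hq
    simp only [dif_pos hp, dif_pos hq]
    exact e.map_rel_iff.2 (show (⟨p, hp⟩ : {l : List B // l.length ≤ n}) < ⟨q, hq⟩ from hpq)

theorem append_singleton_lt_iff (pre : List B) (a b : B) : pre ++ [a] < pre ++ [b] ↔ a < b := by
  induction pre with
  | nil => simp [List.cons_lt_cons_iff]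
  | cons c pre ih => simp [ih]

variable {n : ℕ} {h : List B → A}

/-- A label determines the whole initial segment, not just its last entry, so two branches agree
exactly as far as the lists do. -/
theorem seqMeet_pathImage (hh : StrictMonoOn h {l | l.length ≤ n}) (pre p q : List B)
    (hp : pre.length + p.length ≤ n) (hq : pre.length + q.length ≤ n) :
    seqMeet (pathImage h pre p) (pathImage h pre q) = pathImage h pre (seqMeet p q) := by
  induction p generalizing pre q with
  | nil => simp [pathImage, seqMeet]
  | cons a p ih =>
    cases q with
    | nil => simp [pathImage, seqMeet]
    | cons b q =>
      simp only [List.length_cons] at hp hq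
      by_cases hab : a = b
      · subst hab
        simp only [pathImage, seqMeet, if_true, List.cons.injEq, true_and]
        exact ih _ _ (by simp; omega) (by simp; omega)
      · have : h (pre ++ [a]) ≠ h (pre ++ [b]) := fun heq => hab <| by
          simpa using hh.injOn (by simp; omega) (by simp; omega) heq
        simp [pathImage, seqMeet, hab, this]

theorem pathImage_lt_iff (hh : StrictMonoOn h {l | l.length ≤ n}) (pre p q : List B)
    (hp : pre.length + p.length ≤ n) (hq : pre.length + q.length ≤ n) :
    pathImage h pre p < pathImage h pre q ↔ p < q := by
  induction p generalizing pre q with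
  | nil => cases q <;> simp [pathImage]
  | cons a p ih =>
    cases q with
    | nil => simp [pathImage]
    | cons b q =>
      simp only [List.length_cons] at hp hq
      have ha : pre ++ [a] ∈ {l : List B | l.length ≤ n} := by simp; omega
      have hb : pre ++ [b] ∈ {l : List B | l.length ≤ n} := by simp; omega
      simp only [pathImage, List.cons_lt_cons_iff, hh.lt_iff_lt ha hb,
        append_singleton_lt_iff, hh.injOn.eq_iff ha hb, List.append_cancel_left_eq,
        List.cons.injEq, and_true]
      refine or_congr_right (and_congr_right fun hab => ?_)
      subst hab
      exact ih _ _ (by simp; omega) (by simp; omega)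

/-- The lexicographic comparison of initial segments is determined by the lengths of the lists and
of their meet, and by the comparison of the lists. -/
theorem take_lt_take_iff (p q : List B) (a b : ℕ) :
    p.take a < q.take b ↔
      if min a p.length ≤ (seqMeet p q).length ∨ min b q.length ≤ (seqMeet p q).length
      then min a p.length < min b q.length else p < q := by
  induction p generalizing q a b with
  | nil => cases q <;> cases b <;> simp [seqMeet]
  | cons x p ih =>
    cases q with
    | nil => simp [seqMeet]
    | cons y q =>
      cases a with
      | zero => cases b <;> simp
      | succ a =>
        cases b with
        | zero => simp
        | succ b =>
          by_cases hxy : x = y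
          · subst hxy
            simp [seqMeet, ih]
          · simp [seqMeet, hxy, List.cons_lt_cons_iff]

end PathImage

/-! ### Ranks in finite sets depend only on the order pattern. -/

section Rank

variable {A ι : Type*} [LinearOrder A]

/-- The number of elements of `s` below `a`. -/
def finRank (s : Finset A) (a : A) : ℕ := (s.filter (· < a)).card

theorem finRank_injOn (s : Finset A) : Set.InjOn (finRank s) s := by
  have key : ∀ a ∈ s, ∀ b, a < b → finRank s a < finRank s b := fun a ha b hab => by
    refine Finset.card_lt_card (Finset.ssubset_iff_subset_ne.2 ⟨fun c hc => ?_, fun heq => ?_⟩)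
    · rw [Finset.mem_filter] at hc ⊢
      exact ⟨hc.1, hc.2.trans hab⟩
    · have : a ∈ s.filter (· < a) := by rw [heq, Finset.mem_filter]; exact ⟨ha, hab⟩
      exact lt_irrefl a (Finset.mem_filter.1 this).2
  intro a ha b hb hab
  rcases lt_trichotomy a b with hlt | rfl | hlt
  · exact absurd hab (key a ha b hlt).ne
  · rfl
  · exact absurd hab (key b hb a hlt).ne'

/-- A partial inverse of `finRank s`. -/
noncomputable def finEnum [Nonempty A] (s : Finset A) : ℕ → A := Function.invFunOn (finRank s) s

theorem finEnum_finRank [Nonempty A] {s : Finset A} {a : A} (ha : a ∈ s) :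
    finEnum s (finRank s a) = a :=
  (finRank_injOn s).leftInvOn_invFunOn ha

theorem card_image_le_of_ker {x y : ι → A} (F : Finset ι) (h : ∀ a b, x a = x b → y a = y b) :
    (F.image y).card ≤ (F.image x).card := by
  by_cases hι : Nonempty ι
  · have : F.image y = (F.image x).image fun c => y (Function.invFun x c) := by
      rw [Finset.image_image]
      refine Finset.image_congr fun a _ => ?_
      exact h _ _ (Function.invFun_eq (f := x) ⟨a, rfl⟩).symm
    rw [this]
    exact Finset.card_image_le
  · rw [not_nonempty_iff] at hι
    simp [Finset.eq_empty_of_isEmpty F]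

theorem eq_iff_of_lt_iff {x y : ι → A} (h : ∀ a b, x a < x b ↔ y a < y b) (a b : ι) :
    x a = x b ↔ y a = y b := by
  simp only [le_antisymm_iff, ← not_lt, h]

theorem card_image_eq_of_lt_iff {x y : ι → A} (h : ∀ a b, x a < x b ↔ y a < y b) (F : Finset ι) :
    (F.image x).card = (F.image y).card :=
  le_antisymm (card_image_le_of_ker F fun a b => (eq_iff_of_lt_iff h a b).2)
    (card_image_le_of_ker F fun a b => (eq_iff_of_lt_iff h a b).1)

theorem finRank_eq_of_lt_iff [Fintype ι] {x y : ι → A} (h : ∀ a b, x a < x b ↔ y a < y b)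
    (a : ι) :
    finRank (Finset.univ.image x) (x a) = finRank (Finset.univ.image y) (y a) := by
  simp only [finRank, Finset.filter_image, h]
  exact card_image_eq_of_lt_iff h _

end Rank

/-! ### The data read off from s-similarity: lengths, meets, order. -/

section Similar

open FirstOrder.Language

variable {A : Type u} [LinearOrder A] {n : ℕ} {ι : Type*} {x y : ι → boundedTree A n}

theorem SSimilar.length_eq (h : SSimilar x y) (i : ι) :
    (x i : List A).length = (y i : List A).length := by
  let R : shelahLang.Relations 1 := ShelahRel.level (x i : List A).length
  have := h (R.formula₁ (Term.var i)) (BoundedFormula.IsAtomic.rel _ _).isQF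
  rw [Formula.realize_rel₁, Formula.realize_rel₁] at this
  exact (this.1 (rfl : (x i : List A).length = _)).symm

theorem SSimilar.length_meet_eq (h : SSimilar x y) (i j : ι) :
    (seqMeet (x i : List A) (x j)).length = (seqMeet (y i : List A) (y j)).length := by
  let R : shelahLang.Relations 1 := ShelahRel.level (seqMeet (x i : List A) (x j)).length
  let F : shelahLang.Functions 2 := ShelahFunc.meet
  have := h (R.formula₁ (F.apply₂ (Term.var i) (Term.var j))) (BoundedFormula.IsAtomic.rel _ _).isQF
  rw [Formula.realize_rel₁, Formula.realize_rel₁, Term.realize_functions_apply₂,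
    Term.realize_functions_apply₂] at this
  exact (this.1 (rfl : (seqMeet (x i : List A) (x j)).length = _)).symm

theorem SSimilar.lt_iff (h : SSimilar x y) (i j : ι) :
    (x i : List A) < x j ↔ (y i : List A) < y j := by
  let R : shelahLang.Relations 2 := ShelahRel.lex
  have := h (R.formula₂ (Term.var i) (Term.var j)) (BoundedFormula.IsAtomic.rel _ _).isQF
  rwa [Formula.realize_rel₂, Formula.realize_rel₂] at this

end Similar

/-! ### Label sets and rank codes of tuples, and the theorem. -/

section Main

variable {A B : Type u} [LinearOrder A] {n : ℕ} {h : List B → A}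

/-- The labels on the branches to the members of a tuple. -/
def pathLabels {m : ℕ} (h : List B → A) (n : ℕ) (p : Fin m → List B) (a : Fin m × Fin n) : A :=
  -- Past the end of a list its last label repeats (`h []` for the empty list), so all tuples share
  -- one index set.
  h ((p a.1).take (a.2 + 1))

/-- The set of labels on the branches to the members of a tuple. -/
def pathLabelSet {m : ℕ} (h : List B → A) (n : ℕ) (p : Fin m → List B) : Finset A :=
  Finset.univ.image (pathLabels h n p)

theorem card_pathLabelSet_le {m : ℕ} (p : Fin m → List B) :
    (pathLabelSet h n p).card ≤ m * n := by
  simpa [pathLabelSet] using Finset.card_image_le (s := Finset.univ) (f := pathLabels h n p)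

/-- The branches to the members of a tuple, with labels replaced by their ranks. -/
def pathCode {m : ℕ} (h : List B → A) (n : ℕ) (p : Fin m → List B) (i : Fin m) : List ℕ :=
  (pathImage h [] (p i)).map (finRank (pathLabelSet h n p))

theorem map_finEnum_pathCode [Nonempty A] {m : ℕ} {p : Fin m → List B}
    (hp : ∀ i, (p i).length ≤ n) (i : Fin m) :
    (pathCode h n p i).map (finEnum (pathLabelSet h n p)) = pathImage h [] (p i) := by
  rw [pathCode, List.map_map, pathImage_eq_map, List.map_map]
  refine List.map_congr_left fun j hj => ?_
  have hjn : j < n := (List.mem_range.1 hj).trans_le (hp i)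
  exact finEnum_finRank (Finset.mem_image.2 ⟨(i, ⟨j, hjn⟩), Finset.mem_univ _, rfl⟩)

theorem pathCode_eq {m : ℕ} {p q : Fin m → List B} (hp : ∀ i, (p i).length ≤ n)
    (hlen : ∀ i, (p i).length = (q i).length)
    (hlt : ∀ a b, pathLabels h n p a < pathLabels h n p b ↔
      pathLabels h n q a < pathLabels h n q b) : pathCode h n p = pathCode h n q := by
  funext i
  rw [pathCode, pathCode, pathImage_eq_map, pathImage_eq_map, List.map_map, List.map_map, ← hlen]
  refine List.map_congr_left fun j hj => ?_
  have hjn : j < n := (List.mem_range.1 hj).trans_le (hp i)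
  exact finRank_eq_of_lt_iff hlt (i, ⟨j, hjn⟩)

variable [LinearOrder B]

/-- The substructure of all branches which pass through labels. -/
noncomputable def pathSubstructure (hh : StrictMonoOn h {l | l.length ≤ n}) :
    shelahLang.Substructure (boundedTree A n) where
  carrier := {η | ∃ p : List B, p.length ≤ n ∧ (η : List A) = pathImage h [] p}
  fun_mem g := match g with
    | ShelahFunc.meet => fun x hx => by
        obtain ⟨p, hp, hxp⟩ := hx 0
        obtain ⟨q, hq, hxq⟩ := hx 1
        refine ⟨seqMeet p q, (seqMeet_length_le p q).trans hp, ?_⟩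
        change seqMeet (x 0 : List A) (x 1) = _
        rw [hxp, hxq, seqMeet_pathImage hh [] p q (by simpa using hp) (by simpa using hq)]

theorem isFullyBranching_pathSubstructure (hh : StrictMonoOn h {l | l.length ≤ n}) :
    IsFullyBranching (pathSubstructure hh) #B := by
  refine ⟨⟨[], Nat.zero_le n, rfl⟩, ?_⟩
  rintro η ⟨p, hp, hηp⟩ hη
  rw [hηp, length_pathImage] at hη
  have hlen : ∀ b, (p ++ [b]).length ≤ n := fun b => by simpa using hη
  refine mk_le_of_injective (f := fun b : B => ⟨h (p ++ [b]),
    ⟨pathImage h [] (p ++ [b]), (length_pathImage h [] _).trans_le (hlen b)⟩,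
    ⟨p ++ [b], hlen b, rfl⟩, ?_⟩) fun b c hbc => ?_
  · rw [hηp]
    exact pathImage_append_singleton h [] p b
  · have := hh.injOn (hlen b) (hlen c) (congrArg Subtype.val hbc)
    simpa using this

theorem pathLabels_lt_iff {m : ℕ} (hh : StrictMonoOn h {l | l.length ≤ n})
    {x y : Fin m → boundedTree A n} {p q : Fin m → List B}
    (hp : ∀ i, (p i).length ≤ n) (hq : ∀ i, (q i).length ≤ n)
    (hx : ∀ i, (x i : List A) = pathImage h [] (p i))
    (hy : ∀ i, (y i : List A) = pathImage h [] (q i)) (hxy : SSimilar x y) (a b : Fin m × Fin n) :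
    pathLabels h n p a < pathLabels h n p b ↔ pathLabels h n q a < pathLabels h n q b := by
  have hlen : ∀ i, (p i).length = (q i).length := fun i => by
    simpa only [hx, hy, length_pathImage] using hxy.length_eq i
  have hmeet : ∀ i j, (seqMeet (p i) (p j)).length = (seqMeet (q i) (q j)).length := fun i j => by
    have := hxy.length_meet_eq i j
    rwa [hx, hx, hy, hy, seqMeet_pathImage hh _ _ _ (by simpa using hp i) (by simpa using hp j),
      seqMeet_pathImage hh _ _ _ (by simpa using hq i) (by simpa using hq j), length_pathImage,
      length_pathImage] at this
  have hlt : ∀ i j, p i < p j ↔ q i < q j := fun i j => by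
    have := hxy.lt_iff i j
    rwa [hx, hx, hy, hy, pathImage_lt_iff hh _ _ _ (by simpa using hp i) (by simpa using hp j),
      pathImage_lt_iff hh _ _ _ (by simpa using hq i) (by simpa using hq j)] at this
  have hmem : ∀ (l : List B) (k : ℕ), l.length ≤ n → l.take k ∈ {l : List B | l.length ≤ n} :=
    fun l k hl => (List.length_take_le' k l).trans hl
  simp only [pathLabels]
  rw [hh.lt_iff_lt (hmem _ _ (hp _)) (hmem _ _ (hp _)),
    hh.lt_iff_lt (hmem _ _ (hq _)) (hmem _ _ (hq _)), take_lt_take_iff, take_lt_take_iff]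
  simp only [hlen, hmeet, hlt]

end Main

theorem mk_arrow_countable_le {J : Type} [Countable J] {D : Type u} {χ : Cardinal.{u}}
    (hχ : ℵ₀ ≤ χ) (hD : #D = χ) : #(J → D) ≤ 2 ^ χ := by
  have hχ0 : χ ≠ 0 := (aleph0_pos.trans_le hχ).ne'
  rw [mk_arrow, hD, ← power_self_eq hχ]
  simp only [lift_uzero]
  refine power_le_power_left hχ0 (le_trans ?_ hχ)
  rw [lift_le_aleph0]
  exact mk_le_aleph0

theorem mainTheorem9 (n m : ℕ) :
    ∃ k : ℕ, ∀ χ l : Cardinal.{u}, ℵ₀ ≤ χ → l = Order.succ (bethOver χ k) →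
      ∀ f : (Fin m → boundedTree l.ord.ToType n) → χ.ord.ToType,
        ∃ I : shelahLang.Substructure (boundedTree l.ord.ToType n),
          IsFullyBranching I (Order.succ χ) ∧
          ∀ η ν : Fin m → boundedTree l.ord.ToType n,
            (∀ i, η i ∈ I) → (∀ i, ν i ∈ I) → SSimilar η ν → f η = f ν := by
  -- `m * n` bounds the size of a label set; the extra power passes from χ to the 2^χ colours.
  refine ⟨m * n + 1, fun χ l hχ hl f => ?_⟩
  have hl' : bethOver (2 ^ χ) (m * n) < #l.ord.ToType := by
    rw [mk_ord_toType, hl, bethOver_two_power]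
    exact Order.lt_succ _
  have : Nonempty l.ord.ToType := by
    rw [← mk_ne_zero_iff]
    exact (pos_of_gt hl').ne'
  have hB : #(Order.succ χ).ord.ToType = Order.succ χ := mk_ord_toType _
  have : Infinite (Order.succ χ).ord.ToType := by
    rw [infinite_iff, hB]
    exact hχ.trans (Order.le_succ χ)
  -- `take n` only makes the value well-typed; it changes nothing on codes of actual branches.
  let g : Finset l.ord.ToType → (Fin m → List ℕ) → χ.ord.ToType := fun s σ =>
    f fun i => ⟨((σ i).map (finEnum s)).take n, List.length_take_le _ _⟩
  obtain ⟨H, -, hH, hom⟩ := erdos_rado (hχ.trans (cantor χ).le)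
    (mk_arrow_countable_le hχ (mk_ord_toType χ)) (m * n) Set.univ (by rwa [mk_univ]) g
  obtain ⟨h, hhH, hh⟩ := exists_strictMonoOn_list (B := (Order.succ χ).ord.ToType) n H
    (hB.trans_le (Order.succ_le_of_lt (cantor χ)) |>.trans_lt hH)
  refine ⟨pathSubstructure hh, ?_, fun η ν hη hν hs => ?_⟩
  · have := isFullyBranching_pathSubstructure hh
    rwa [hB] at this
  choose p hp hηp using hη
  choose q hq hνq using hν
  have hlt := pathLabels_lt_iff hh hp hq hηp hνq hs
  have hlen : ∀ i, (p i).length = (q i).length := fun i => by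
    simpa only [hηp, hνq, length_pathImage] using hs.length_eq i
  have key : ∀ (x : Fin m → boundedTree l.ord.ToType n) (r : Fin m → List _),
      (∀ i, (r i).length ≤ n) → (∀ i, (x i : List l.ord.ToType) = pathImage h [] (r i)) →
      f x = g (pathLabelSet h n r) (pathCode h n r) := by
    intro x r hr hx
    refine congrArg f (funext fun i => Subtype.ext ?_)
    change _ = List.take n _
    rw [map_finEnum_pathCode hr, ← hx, List.take_of_length_le (x i).2]
  have hsub : ∀ r : Fin m → List _, (∀ i, (r i).length ≤ n) → ↑(pathLabelSet h n r) ⊆ H := by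
    intro r hr a ha
    obtain ⟨b, -, rfl⟩ := Finset.mem_image.1 (Finset.mem_coe.1 ha)
    exact hhH _ ((List.length_take_le' _ _).trans (hr _))
  rw [key η p hp hηp, key ν q hq hνq, pathCode_eq hp hlen hlt,
    hom _ _ (hsub p hp) (hsub q hq) (card_image_eq_of_lt_iff hlt _) (card_pathLabelSet_le p)]
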